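/- **Theorem (Estimating non-classicality).** Consider $n$ bosonic modes with Hilbert space $L^2(\mathbb R^n)$ and canonical coordinates $R=(q_1,\dots,q_n,p_1,\dots,p_n)$, where $q_j$ is multiplication by $x_j$ and $p_j=-i\partial_j$. Let $\sigma=\begin{pmatrix}0&\mathbb 1_n\\-\mathbb 1_n&0\end{pmatrix}$, let $D(\xi)=e^{i\xi\cdot\sigma R}$ for $\xi\in\mathbb R^{2n}$, and let a state $\rho$ (a positive trace class operator of trace $1$) have the characteristic function $\chi_\rho(\xi)=\operatorname{tr}[\rho D(\xi)]$ and the Wigner function $W_\rho(z)=(2\pi)^{-2n}\int\chi_\rho(\xi)e^{-i\xi\cdot\sigma z}\,d\xi$. (As $\chi_\rho$ is square integrable but in general not integrable, the integral is understood as the Fourier transform in $L^2$, equivalently of tempered distributions, so that $W_\rho\in L^2(\mathbb R^{2n})$ is determined almost everywhere.) Let $\mathcal C$ be the set of all states $\omega$ with $W_\omega\ge 0$ almost everywhere, and define the non-classicality of $\rho$ by $$\eta(\rho)=\inf_{\omega\in\mathcal C}\|\rho-\omega\|_1,\qquad \|A\|_1=\operatorname{tr}|A| .$$ For $\lambda\in\mathbb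 R$, a function $\chi:\mathbb R^{2n}\to\mathbb C$ and vectors $T=(\xi_1,\dots,\xi_m)$ in $\mathbb R^{2n}$, let $M^{(\lambda)}(\chi,T)$ be the $m\times m$ matrix with entries $\chi(\xi_k-\xi_l)\,e^{i\lambda\,\xi_k\cdot\sigma\xi_l/2}$. Let $\rho$ be a state, let $\bar\xi_1,\dots,\bar\xi_p\in\mathbb R^{2n}$, $c_j\in\mathbb C$ and $\delta_j\ge0$ be data with $|\chi_\rho(\bar\xi_j)-c_j|\le\delta_j$ for all $j$, and let $T=(\xi_1,\dots,\xi_m)$ be any test vectors in $\mathbb R^{2n}$. Let $x'\in[-\infty,\infty]$ be the optimal value of the semidefinite program that minimizes $x$ over all $x\in\mathbb R$ and all $\chi:\mathbb R^{2n}\to\mathbb C$ with $\chi(-\xi)=\overline{\chi(\xi)}$ for all $\xi$, subject to $$|\operatorname{Re}\chi(\bar\xi_j)-\operatorname{Re}c_j|\le\delta_j,\qquad |\operatorname{Im}\chi(\bar\xi_j)-\operatorname{Im}c_j|\le\delta_j\qquad(j=1,\dots,p),$$ $$M^{(0)}(\chi,T)+x\,m\,\mathbb 1\ge0,\qquad M^{(1)}(\chi,T)\ge0,$$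 that is, the infimum of $x$ over all feasible $(\chi,x)$. Then $\eta(\rho)\ge x'$. -/

import Mathlib

open MeasureTheory Matrix
open scoped ENNReal SchwartzMap ComplexConjugate ComplexOrder

noncomputable section

namespace NonClassicality

/-! ## Trace and trace norm on a Hilbert space -/

section TraceClass

variable {E : Type*} [NormedAddCommGroup E] [InnerProductSpace ℂ E] [CompleteSpace E]

/-- An index set of an orthonormal (Hilbert) basis of `E`. -/
def basisIndex (E : Type*) [NormedAddCommGroup E] [InnerProductSpace ℂ E] [CompleteSpace E] :
    Set E :=
  Classical.choose (exists_hilbertBasis ℂ E)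

/-- An orthonormal (Hilbert) basis of `E`. The trace and the trace norm below do not depend on
which one is used. -/
def onb (E : Type*) [NormedAddCommGroup E] [InnerProductSpace ℂ E] [CompleteSpace E] :
    HilbertBasis (basisIndex E) ℂ E :=
  Classical.choose (Classical.choose_spec (exists_hilbertBasis ℂ E))

/-- The trace norm `‖A‖₁ = tr |A|`, where `|A| = (A† A)^{1/2}`; it is `∞` if `A` is not of
trace class. -/
def traceNorm (A : E →L[ℂ] E) : ℝ≥0∞ :=
  ∑' i, ENNReal.ofReal (inner ℂ (onb E i) (CFC.abs A (onb E i))).re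

/-- `A` is of trace class. -/
def IsTraceClass (A : E →L[ℂ] E) : Prop := traceNorm A < ∞

/-- The trace `tr A = ∑ᵢ ⟨eᵢ, A eᵢ⟩` (of a trace class operator). -/
def trace (A : E →L[ℂ] E) : ℂ := ∑' i, inner ℂ (onb E i) (A (onb E i))

/-- Quantum states: positive trace class operators of unit trace. -/
structure IsState (ρ : E →L[ℂ] E) : Prop where
  isPositive : ρ.IsPositive
  isTraceClass : IsTraceClass ρ
  trace_eq_one : trace ρ = 1

end TraceClass

/-! ## Bosonic modes: phase space and displacement operators -/

/-- The configuration space `ℝⁿ`. -/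
abbrev Config (n : ℕ) : Type := EuclideanSpace ℝ (Fin n)

/-- The phase space `ℝ²ⁿ`; the left summand indexes the positions, the right one the momenta. -/
abbrev PhaseSpace (n : ℕ) : Type := EuclideanSpace ℝ (Fin n ⊕ Fin n)

/-- The Hilbert space `L²(ℝⁿ)` of `n` bosonic modes. -/
abbrev Modes (n : ℕ) : Type := Lp ℂ 2 (volume : Measure (Config n))

/-- The matrix `σ = [0, 1; -1, 0]`. -/
def sigma (n : ℕ) : Matrix (Fin n ⊕ Fin n) (Fin n ⊕ Fin n) ℝ :=
  Matrix.fromBlocks 0 1 (-1) 0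

/-- The symplectic product `ξ · σ z`. -/
def symp {n : ℕ} (ξ z : PhaseSpace n) : ℝ := (ξ : Fin n ⊕ Fin n → ℝ) ⬝ᵥ (sigma n *ᵥ z)

/-- The position part `a` of `ξ = (a, b)`. -/
def posPart {n : ℕ} (ξ : PhaseSpace n) : Config n := WithLp.toLp 2 fun i => ξ (Sum.inl i)

/-- The momentum part `b` of `ξ = (a, b)`. -/
def momPart {n : ℕ} (ξ : PhaseSpace n) : Config n := WithLp.toLp 2 fun i => ξ (Sum.inr i)

/-- The unimodular function `x ↦ exp (-i (b · x + a · b / 2))` for `ξ = (a, b)`. -/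
def weylPhase {n : ℕ} (ξ : PhaseSpace n) (x : Config n) : ℂ :=
  Complex.exp (-Complex.I *
    ((inner ℝ (momPart ξ) x + inner ℝ (posPart ξ) (momPart ξ) / 2 : ℝ) : ℂ))

/-- The action of `D(ξ) = exp (i ξ · σ R)` on wave functions. With `R = (q, p)`, `q` the
multiplication by `x` and `p = -i ∇`, one has `ξ · σ R = a · p - b · q` for `ξ = (a, b)`, and hence
`(D(ξ) f)(x) = exp (-i (b · x + a · b / 2)) f (x + a)`. -/
def weylFun {n : ℕ} (ξ : PhaseSpace n) (f : Config n → ℂ) : Config n → ℂ :=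
  fun x => weylPhase ξ x * f (x + posPart ξ)

/-- The Schrödinger equation `d/dt D(tξ) f = i (ξ · σ R) D(tξ) f`, where
`i (ξ · σ R) g = a · ∇ g - i (b · x) g`, for differentiable `f`. -/
theorem hasDerivAt_weylFun {n : ℕ} (ξ : PhaseSpace n) (f : Config n → ℂ)
    (hf : Differentiable ℝ f) (t : ℝ) (x : Config n) :
    HasDerivAt (fun s : ℝ => weylFun (s • ξ) f x)
      (fderiv ℝ (weylFun (t • ξ) f) x (posPart ξ) -
        Complex.I * ((inner ℝ (momPart ξ) x : ℝ) : ℂ) * weylFun (t • ξ) f x) t := by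
  have hp : ∀ s : ℝ, posPart (s • ξ) = s • posPart ξ := fun s => by ext i; simp [posPart]
  have hm : ∀ s : ℝ, momPart (s • ξ) = s • momPart ξ := fun s => by ext i; simp [momPart]
  set a := posPart ξ with ha
  set b := momPart ξ with hb
  have hw : ∀ (s : ℝ) (y : Config n), weylPhase (s • ξ) y =
      Complex.exp (-Complex.I * ((s * inner ℝ b y + s * (s * inner ℝ a b) / 2 : ℝ) : ℂ)) := by
    intro s y
    simp only [weylPhase, hp, hm, inner_smul_left, inner_smul_right, RCLike.conj_to_real]
  -- the derivative in `t`
  have h1 : HasDerivAt (fun s : ℝ => f (x + s • a)) (fderiv ℝ f (x + t • a) a) t := by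
    have h := (hf (x + t • a)).hasFDerivAt.comp_hasDerivAt t
      (((hasDerivAt_id t).smul_const a).const_add x)
    simpa [Function.comp_def] using h
  have h2 : HasDerivAt (fun s : ℝ => weylPhase (s • ξ) x)
      (weylPhase (t • ξ) x * (-Complex.I * ((inner ℝ b x + t * inner ℝ a b : ℝ) : ℂ))) t := by
    simp only [hw]
    have h : HasDerivAt (fun s : ℝ => s * inner ℝ b x + s * (s * inner ℝ a b) / 2)
        (inner ℝ b x + t * inner ℝ a b) t := by
      have h3 := ((hasDerivAt_id t).mul_const (inner ℝ b x)).add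
        (((hasDerivAt_id t).mul ((hasDerivAt_id t).mul_const (inner ℝ a b))).div_const 2)
      refine h3.congr_deriv ?_
      simp only [id]
      ring
    exact (h.ofReal_comp.const_mul (-Complex.I)).cexp
  -- the directional derivative in `x`
  have h4 : HasDerivAt (fun s : ℝ => weylFun (t • ξ) f (x + s • a))
      (weylPhase (t • ξ) x * (-Complex.I * ((t * inner ℝ b a : ℝ) : ℂ)) * f (x + t • a) +
        weylPhase (t • ξ) x * fderiv ℝ f (x + t • a) a) 0 := by
    have h5 : HasDerivAt (fun s : ℝ => f (x + s • a + t • a)) (fderiv ℝ f (x + t • a) a) 0 := by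
      have hx : HasFDerivAt f (fderiv ℝ f (x + t • a)) (x + (0 : ℝ) • a + t • a) := by
        simpa using (hf (x + t • a)).hasFDerivAt
      have h := hx.comp_hasDerivAt (0 : ℝ)
        ((((hasDerivAt_id (0 : ℝ)).smul_const a).const_add x).add_const (t • a))
      simpa [Function.comp_def] using h
    have h6 : HasDerivAt (fun s : ℝ => weylPhase (t • ξ) (x + s • a))
        (weylPhase (t • ξ) x * (-Complex.I * ((t * inner ℝ b a : ℝ) : ℂ))) 0 := by
      simp only [hw]
      have h : HasDerivAt
          (fun s : ℝ => t * inner ℝ b (x + s • a) + t * (t * inner ℝ a b) / 2)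
          (t * inner ℝ b a) 0 := by
        simp only [inner_add_right, inner_smul_right]
        have h3 := ((((hasDerivAt_id (0 : ℝ)).mul_const (inner ℝ b a)).const_add
          (inner ℝ b x)).const_mul t).add_const (t * (t * inner ℝ a b) / 2)
        simpa using h3
      simpa using (h.ofReal_comp.const_mul (-Complex.I)).cexp
    have h := h6.mul h5
    simp only [zero_smul, add_zero] at h
    have e : (fun s : ℝ => weylFun (t • ξ) f (x + s • a)) =
        (fun s : ℝ => weylPhase (t • ξ) (x + s • a)) * fun s : ℝ => f (x + s • a + t • a) := by
      funext s
      simp [weylFun, hp]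
    rw [e]
    exact h
  have hd : DifferentiableAt ℝ (weylFun (t • ξ) f) x := by
    have hin : Differentiable ℝ fun y : Config n => inner ℝ b y :=
      (innerSL ℝ b).differentiable
    have hre : Differentiable ℝ fun y : Config n =>
        t * inner ℝ b y + t * (t * inner ℝ a b) / 2 := by fun_prop
    have hco : Differentiable ℝ fun y : Config n =>
        ((t * inner ℝ b y + t * (t * inner ℝ a b) / 2 : ℝ) : ℂ) :=
      Complex.ofRealCLM.differentiable.comp hre
    have hph : Differentiable ℝ fun y : Config n => weylPhase (t • ξ) y := by
      simp only [hw]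
      exact (hco.const_mul (-Complex.I)).cexp
    exact (hph.mul (hf.comp (differentiable_id.add_const (posPart (t • ξ))))) x
  have h7 : HasDerivAt (fun s : ℝ => weylFun (t • ξ) f (x + s • a))
      (fderiv ℝ (weylFun (t • ξ) f) x a) 0 := by
    have hx : HasFDerivAt (weylFun (t • ξ) f) (fderiv ℝ (weylFun (t • ξ) f) x)
        (x + (0 : ℝ) • a) := by simpa using hd.hasFDerivAt
    have h := hx.comp_hasDerivAt (0 : ℝ) (((hasDerivAt_id (0 : ℝ)).smul_const a).const_add x)
    simpa [Function.comp_def] using h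
  have h8 := h2.mul h1
  rw [h7.unique h4]
  have e : (fun s : ℝ => weylFun (s • ξ) f x) =
      (fun s : ℝ => weylPhase (s • ξ) x) * fun s : ℝ => f (x + s • a) := by
    funext s
    simp [weylFun, hp]
  rw [e]
  refine h8.congr_deriv ?_
  rw [real_inner_comm a b]
  simp only [weylFun, hp]
  push_cast
  ring

theorem norm_weylPhase {n : ℕ} (ξ : PhaseSpace n) (x : Config n) : ‖weylPhase ξ x‖ = 1 := by
  rw [weylPhase, neg_mul, ← mul_neg, mul_comm, ← Complex.ofReal_neg]
  exact Complex.norm_exp_ofReal_mul_I _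

theorem continuous_weylPhase {n : ℕ} (ξ : PhaseSpace n) : Continuous (weylPhase ξ) := by
  unfold weylPhase
  fun_prop

theorem measurePreserving_shift {n : ℕ} (a : Config n) :
    MeasurePreserving (fun x : Config n => x + a) volume volume :=
  measurePreserving_add_right volume a

theorem aestronglyMeasurable_weylFun {n : ℕ} (ξ : PhaseSpace n) {f : Config n → ℂ}
    (hf : AEStronglyMeasurable f volume) : AEStronglyMeasurable (weylFun ξ f) volume :=
  (continuous_weylPhase ξ).aestronglyMeasurable.mul
    (hf.comp_measurePreserving (measurePreserving_shift (posPart ξ)))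

theorem eLpNorm_weylFun {n : ℕ} (ξ : PhaseSpace n) {f : Config n → ℂ}
    (hf : AEStronglyMeasurable f volume) :
    eLpNorm (weylFun ξ f) 2 volume = eLpNorm f 2 volume := by
  rw [← eLpNorm_comp_measurePreserving hf (measurePreserving_shift (posPart ξ))]
  refine eLpNorm_congr_norm_ae (Filter.Eventually.of_forall fun x => ?_)
  simp [weylFun, norm_weylPhase]

theorem memLp_weylFun {n : ℕ} (ξ : PhaseSpace n) (f : Modes n) :
    MemLp (weylFun ξ f) 2 volume :=
  ⟨aestronglyMeasurable_weylFun ξ (Lp.aestronglyMeasurable f), by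
    rw [eLpNorm_weylFun ξ (Lp.aestronglyMeasurable f)]
    exact Lp.eLpNorm_lt_top f⟩

theorem weylFun_congr {n : ℕ} (ξ : PhaseSpace n) {f g : Config n → ℂ} (h : f =ᵐ[volume] g) :
    weylFun ξ f =ᵐ[volume] weylFun ξ g := by
  have h' := (measurePreserving_shift (posPart ξ)).quasiMeasurePreserving.ae_eq_comp h
  filter_upwards [h'] with x hx
  simp only [Function.comp_apply] at hx
  simp only [weylFun, hx]

/-- The displacement (Weyl) operator `D(ξ) = exp (i ξ · σ R)` on `L²(ℝⁿ)`. -/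
def displacement {n : ℕ} (ξ : PhaseSpace n) : Modes n →L[ℂ] Modes n :=
  LinearIsometry.toContinuousLinearMap
    { toFun := fun f => (memLp_weylFun ξ f).toLp (weylFun ξ f)
      map_add' := fun f g => by
        rw [← MemLp.toLp_add, MemLp.toLp_eq_toLp_iff]
        refine (weylFun_congr ξ (Lp.coeFn_add f g)).trans (Filter.Eventually.of_forall fun x => ?_)
        simp [weylFun, mul_add]
      map_smul' := fun c f => by
        rw [RingHom.id_apply, ← MemLp.toLp_const_smul, MemLp.toLp_eq_toLp_iff]
        refine (weylFun_congr ξ (Lp.coeFn_smul c f)).trans (Filter.Eventually.of_forall fun x => ?_)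
        simp [weylFun, mul_left_comm]
      norm_map' := fun f => by
        refine (Lp.norm_toLp _ (memLp_weylFun ξ f)).trans ?_
        rw [eLpNorm_weylFun ξ (Lp.aestronglyMeasurable f), Lp.norm_def] }

/-! ## Characteristic function, Wigner function and non-classicality -/

/-- The quantum characteristic function `χ(ξ) = tr[ρ D(ξ)]`. -/
def charFn {n : ℕ} (ρ : Modes n →L[ℂ] Modes n) (ξ : PhaseSpace n) : ℂ :=
  trace (ρ * displacement ξ)

/-- `W` is the Wigner function of `ρ`, the Fourier transform
`W(z) = (2π)^{-2n} ∫ χ(ξ) e^{-i ξ · σ z} dξ` of the characteristic function. As `χ` is in general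
square integrable but not integrable, `W` is a square integrable function and the formula is
read as the Fourier transform of `χ` as a tempered distribution, i.e. against Schwartz functions
`φ` (it determines `W` almost everywhere). -/
def IsWignerFunction {n : ℕ} (ρ : Modes n →L[ℂ] Modes n) (W : PhaseSpace n → ℝ) : Prop :=
  MemLp W 2 volume ∧
    ∀ φ : 𝓢(PhaseSpace n, ℂ),
      ∫ z, (W z : ℂ) * φ z =
        ∫ ξ, charFn ρ ξ *
          (((2 * Real.pi : ℂ) ^ (2 * n))⁻¹ * ∫ z, Complex.exp (-Complex.I * (symp ξ z : ℂ)) * φ z)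

/-- The set `𝒞` of all quantum states with positive (i.e. nonnegative) Wigner function. -/
def classicalStates (n : ℕ) : Set (Modes n →L[ℂ] Modes n) :=
  {ω | IsState ω ∧ ∃ W : PhaseSpace n → ℝ, IsWignerFunction ω W ∧ ∀ᵐ z, 0 ≤ W z}

/-- The measure of non-classicality `η(ρ)`: the trace norm distance of `ρ` to `𝒞`. -/
def nonClassicality {n : ℕ} (ρ : Modes n →L[ℂ] Modes n) : ℝ≥0∞ :=
  ⨅ ω ∈ classicalStates n, traceNorm (ρ - ω)

/-! ## The semi-definite program -/

/-- The Bochner matrix `M^{(r)}(χ, T)`, with entries `χ(ξₖ - ξₗ) e^{i r ξₖ · σ ξₗ / 2}`, for the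
test vectors `T = (ξ₁, …, ξₘ)`. -/
def bochnerMatrix {n m : ℕ} (r : ℝ) (χ : PhaseSpace n → ℂ) (T : Fin m → PhaseSpace n) :
    Matrix (Fin m) (Fin m) ℂ :=
  Matrix.of fun k l =>
    χ (T k - T l) * Complex.exp (Complex.I * ((r * symp (T k) (T l) / 2 : ℝ) : ℂ))

/-- Feasible points `(χ, x)` of the program with data points `ξbar`, estimates `c` of the
characteristic function with errors `δ`, and test vectors `T`. -/
structure SDPFeasible {n p m : ℕ} (ξbar : Fin p → PhaseSpace n) (c : Fin p → ℂ) (δ : Fin p → ℝ)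
    (T : Fin m → PhaseSpace n) (χ : PhaseSpace n → ℂ) (x : ℝ) : Prop where
  hermitian : ∀ ξ, χ (-ξ) = conj (χ ξ)
  data_re : ∀ j, |(χ (ξbar j)).re - (c j).re| ≤ δ j
  data_im : ∀ j, |(χ (ξbar j)).im - (c j).im| ≤ δ j
  zero_pos : (bochnerMatrix 0 χ T + ((x * m : ℝ) : ℂ) • (1 : Matrix (Fin m) (Fin m) ℂ)).PosSemidef
  one_pos : (bochnerMatrix 1 χ T).PosSemidef

/-- The optimal value `x'` of the program: the infimum of `x` over all feasible `(χ, x)`, taken in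
the extended reals. -/
def sdpValue {n p m : ℕ} (ξbar : Fin p → PhaseSpace n) (c : Fin p → ℂ) (δ : Fin p → ℝ)
    (T : Fin m → PhaseSpace n) : EReal :=
  ⨅ (χ : PhaseSpace n → ℂ) (x : ℝ) (_ : SDPFeasible ξbar c δ T χ x), (x : EReal)

end NonClassicality

end

/-! For each classical `ω` at finite distance `t = ‖ρ - ω‖₁`, the pair `(χ_ρ, t)` is feasible, so
`x' ≤ t`; the infimum over `ω` gives the bound (`sdpFeasible_charFn`).

Feasibility rests on three facts. The form of `M^{(1)}(χ_ρ, T)` is `tr[ρ X X†]` with `X` a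
combination of displacements, hence nonnegative. `M^{(0)}(χ_ω, T) ≥ 0` is Bochner's theorem for the
nonnegative function `W_ω`. Finally `|tr[(ρ - ω) D(ξ)]| ≤ t` as `‖D(ξ)‖ ≤ 1`, so `M^{(0)}(χ_ρ - χ_ω,
T)` has entries of modulus at most `t`, and a Hermitian `m × m` matrix of this kind is bounded below
by `-t m`.

The analytic core is `sum_conj_mul_mul_nonneg`: `W_ω` is only square integrable and known through
pairings with Schwartz functions, so it is tested on modulated Gaussians, whose width is then sent
to infinity. The limit needs `χ_ω` continuous, which follows from weak continuity of `ξ ↦ D(ξ)`.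
Traces `tr[A X]` with `A ≥ 0` are all rewritten as `∑ᵢ ⟨S eᵢ, X S eᵢ⟩` with `S = √A`, where
positivity, bounds and continuity can be read off termwise. -/

namespace NonClassicality

/-! ### Hilbert–Schmidt operators and cyclicity -/

section HilbertSchmidt

variable {E : Type*} [NormedAddCommGroup E] [InnerProductSpace ℂ E] [CompleteSpace E]

omit [CompleteSpace E] in
theorem hasSum_norm_inner_sq {ι : Type*} (b : HilbertBasis ι ℂ E) (x : E) :
    HasSum (fun i => ‖inner ℂ (b i) x‖ ^ 2) (‖x‖ ^ 2) := by
  have h := Complex.hasSum_re (b.hasSum_inner_mul_inner x x)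
  have h1 : (inner ℂ x x).re = ‖x‖ ^ 2 := by
    rw [inner_self_eq_norm_sq_to_K]; norm_cast
  rw [h1] at h
  refine h.congr_fun fun i => ?_
  rw [← inner_conj_symm x, ← Complex.normSq_eq_conj_mul_self, Complex.normSq_eq_norm_sq,
    Complex.ofReal_re]

/-- The Hilbert--Schmidt operators. -/
def IsHilbertSchmidt (S : E →L[ℂ] E) : Prop := Summable fun i => ‖S (onb E i)‖ ^ 2

theorem IsHilbertSchmidt.summable_prod {S : E →L[ℂ] E} (hS : IsHilbertSchmidt S) :
    Summable fun x : basisIndex E × basisIndex E => ‖inner ℂ (onb E x.2) (S (onb E x.1))‖ ^ 2 := by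
  refine (summable_prod_of_nonneg (f := fun x : basisIndex E × basisIndex E =>
    ‖inner ℂ (onb E x.2) (S (onb E x.1))‖ ^ 2) fun _ => sq_nonneg _).2
    ⟨fun i => (hasSum_norm_inner_sq (onb E) (S (onb E i))).summable, ?_⟩
  exact hS.congr fun i => (hasSum_norm_inner_sq (onb E) (S (onb E i))).tsum_eq.symm

/-- Taking adjoints transposes the double series of squared matrix entries, which is summable in
either order. -/
theorem IsHilbertSchmidt.adjoint {S : E →L[ℂ] E} (hS : IsHilbertSchmidt S) :
    IsHilbertSchmidt (star S) := by
  have h := hS.summable_prod.prod_symm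
  have h' := ((summable_prod_of_nonneg fun _ => sq_nonneg _).1 h).2
  refine h'.congr fun j => ?_
  rw [← (hasSum_norm_inner_sq (onb E) (star S (onb E j))).tsum_eq]
  refine tsum_congr fun i => ?_
  simp only [Prod.swap_prod_mk]
  rw [ContinuousLinearMap.star_eq_adjoint, ContinuousLinearMap.adjoint_inner_right,
    norm_inner_symm]

theorem IsHilbertSchmidt.mul_left {S : E →L[ℂ] E} (hS : IsHilbertSchmidt S) (X : E →L[ℂ] E) :
    IsHilbertSchmidt (X * S) := by
  refine Summable.of_nonneg_of_le (fun _ => sq_nonneg _) (fun i => ?_)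
    (Summable.mul_left (‖X‖ ^ 2) hS)
  rw [← mul_pow]
  exact pow_le_pow_left₀ (norm_nonneg _) (X.le_opNorm _) 2

theorem IsHilbertSchmidt.mul_right {S : E →L[ℂ] E} (hS : IsHilbertSchmidt S) (X : E →L[ℂ] E) :
    IsHilbertSchmidt (S * X) := by
  simpa using (hS.adjoint.mul_left (star X)).adjoint

theorem IsHilbertSchmidt.summable_inner {S T : E →L[ℂ] E} (hS : IsHilbertSchmidt S)
    (hT : IsHilbertSchmidt T) : Summable fun i => inner ℂ (S (onb E i)) (T (onb E i)) := by
  refine Summable.of_norm_bounded (hS.add hT) fun i => ?_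
  refine (norm_inner_le_norm _ _).trans ?_
  nlinarith [sq_nonneg (‖S (onb E i)‖ - ‖T (onb E i)‖), sq_nonneg ‖S (onb E i)‖,
    sq_nonneg ‖T (onb E i)‖]

/-- This is `tr(S† T) = tr(T S†)`: Parseval expands both sides into one absolutely convergent double
series, and Fubini exchanges the sums. -/
theorem IsHilbertSchmidt.tsum_inner_adjoint {S T : E →L[ℂ] E} (hS : IsHilbertSchmidt S)
    (hT : IsHilbertSchmidt T) :
    ∑' i, inner ℂ (S (onb E i)) (T (onb E i)) =
      ∑' j, inner ℂ (star T (onb E j)) (star S (onb E j)) := by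
  have hsum : Summable (Function.uncurry fun i j =>
      inner ℂ (S (onb E i)) (onb E j) * inner ℂ (onb E j) (T (onb E i))) := by
    refine Summable.of_norm_bounded (hS.summable_prod.add hT.summable_prod) fun x => ?_
    simp only [Function.uncurry, norm_mul]
    rw [norm_inner_symm]
    nlinarith [sq_nonneg (‖inner ℂ (onb E x.2) (S (onb E x.1))‖ -
      ‖inner ℂ (onb E x.2) (T (onb E x.1))‖),
      sq_nonneg ‖inner ℂ (onb E x.2) (S (onb E x.1))‖,
      sq_nonneg ‖inner ℂ (onb E x.2) (T (onb E x.1))‖]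
  have h1 : ∀ i, inner ℂ (S (onb E i)) (T (onb E i)) =
      ∑' j, inner ℂ (S (onb E i)) (onb E j) * inner ℂ (onb E j) (T (onb E i)) :=
    fun i => ((onb E).tsum_inner_mul_inner _ _).symm
  have h2 : ∀ j, inner ℂ (star T (onb E j)) (star S (onb E j)) =
      ∑' i, inner ℂ (S (onb E i)) (onb E j) * inner ℂ (onb E j) (T (onb E i)) := by
    intro j
    rw [← (onb E).tsum_inner_mul_inner]
    refine tsum_congr fun i => ?_
    simp only [ContinuousLinearMap.star_eq_adjoint, ContinuousLinearMap.adjoint_inner_right,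
      ContinuousLinearMap.adjoint_inner_left]
    ring
  simp only [h1, h2]
  exact hsum.tsum_comm.symm

end HilbertSchmidt

/-! ### Traces against trace class operators -/

section Trace

variable {E : Type*} [NormedAddCommGroup E] [InnerProductSpace ℂ E] [CompleteSpace E]

/-- A square root `S` of a positive trace class operator `A` expresses all traces `tr (A X)`. -/
structure IsTraceRoot (A S : E →L[ℂ] E) : Prop where
  isHilbertSchmidt : IsHilbertSchmidt S
  norm_sq : ∀ i, ‖S (onb E i)‖ ^ 2 = (inner ℂ (onb E i) (A (onb E i))).re
  summable : ∀ X : E →L[ℂ] E, Summable fun i => inner ℂ (onb E i) ((A * X) (onb E i))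
  trace_mul : ∀ X : E →L[ℂ] E, trace (A * X) = ∑' i, inner ℂ (S (onb E i)) (X (S (onb E i)))

/-- With `S = √A`, cyclicity applied to the Hilbert–Schmidt operators `S` and `S X` moves one root
to the other side: `tr(S · S X) = tr(S X S)`. -/
theorem exists_isTraceRoot {A : E →L[ℂ] E} (hA : 0 ≤ A)
    (hs : Summable fun i => (inner ℂ (onb E i) (A (onb E i))).re) :
    ∃ S, IsTraceRoot A S := by
  have hSS : CFC.sqrt A * CFC.sqrt A = A := CFC.sqrt_mul_sqrt_self A hA
  have hsa : star (CFC.sqrt A) = CFC.sqrt A := (CFC.sqrt_nonneg A).isSelfAdjoint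
  generalize CFC.sqrt A = S at hSS hsa
  have hin : ∀ x y, inner ℂ x (S y) = inner ℂ (S x) y := fun x y => by
    conv_lhs => rw [← hsa]
    rw [ContinuousLinearMap.star_eq_adjoint, ContinuousLinearMap.adjoint_inner_right]
  have hA' : ∀ x y, inner ℂ x (A y) = inner ℂ (S x) (S y) := fun x y => by
    rw [← hSS, mul_apply_eq_comp, hin]
  have hn : ∀ i, ‖S (onb E i)‖ ^ 2 = (inner ℂ (onb E i) (A (onb E i))).re := fun i => by
    rw [hA', inner_self_eq_norm_sq_to_K]; norm_cast
  have hS : IsHilbertSchmidt S := hs.congr fun i => (hn i).symm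
  refine ⟨S, hS, hn, fun X => ?_, fun X => ?_⟩
  · have h := hS.summable_inner (hS.mul_right X)
    simpa only [mul_apply_eq_comp, hA'] using h
  · have h := hS.tsum_inner_adjoint (hS.mul_right X)
    simp only [mul_apply_eq_comp] at h
    simp only [trace, mul_apply_eq_comp, hA']
    refine h.trans (tsum_congr fun j => ?_)
    rw [star_mul, hsa, mul_apply_eq_comp, ContinuousLinearMap.star_eq_adjoint,
      ContinuousLinearMap.adjoint_inner_left]

namespace IsTraceRoot

variable {A S : E →L[ℂ] E}

theorem summable_inner (h : IsTraceRoot A S) (X : E →L[ℂ] E) :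
    Summable fun i => inner ℂ (S (onb E i)) (X (S (onb E i))) := by
  have h' := h.isHilbertSchmidt.summable_inner (h.isHilbertSchmidt.mul_left X)
  simpa only [mul_apply_eq_comp] using h'

theorem norm_inner_apply_le (S X : E →L[ℂ] E) (i) :
    ‖inner ℂ (S (onb E i)) (X (S (onb E i)))‖ ≤ ‖X‖ * ‖S (onb E i)‖ ^ 2 := by
  refine (norm_inner_le_norm _ _).trans ?_
  nlinarith [mul_le_mul_of_nonneg_left (X.le_opNorm (S (onb E i))) (norm_nonneg (S (onb E i)))]

theorem norm_trace_mul_le (h : IsTraceRoot A S) (X : E →L[ℂ] E) :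
    ‖trace (A * X)‖ ≤ ‖X‖ * ∑' i, (inner ℂ (onb E i) (A (onb E i))).re := by
  rw [h.trace_mul]
  have hs : Summable fun i => ‖X‖ * ‖S (onb E i)‖ ^ 2 := Summable.mul_left ‖X‖ h.isHilbertSchmidt
  refine (tsum_of_norm_bounded hs.hasSum (norm_inner_apply_le S X)).trans ?_
  rw [tsum_mul_left]
  simp only [h.norm_sq, le_refl]

theorem trace_mul_star (h : IsTraceRoot A S) (X : E →L[ℂ] E) : trace (A * star X) = conj (trace (A * X)) := by
  rw [h.trace_mul, h.trace_mul, Complex.conj_tsum]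
  refine tsum_congr fun i => ?_
  rw [ContinuousLinearMap.star_eq_adjoint, ContinuousLinearMap.adjoint_inner_right,
    inner_conj_symm]

theorem trace_mul_mul_star_nonneg (h : IsTraceRoot A S) (X : E →L[ℂ] E) : 0 ≤ trace (A * (X * star X)) := by
  rw [h.trace_mul]
  refine tsum_nonneg fun i => ?_
  rw [mul_apply_eq_comp, ← ContinuousLinearMap.adjoint_inner_left,
    ← ContinuousLinearMap.star_eq_adjoint, inner_self_eq_norm_sq_to_K]
  exact pow_nonneg (Complex.zero_le_real.2 (norm_nonneg (star X (S (onb E i))))) 2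

theorem trace_mul_add (h : IsTraceRoot A S) (X Y : E →L[ℂ] E) :
    trace (A * (X + Y)) = trace (A * X) + trace (A * Y) := by
  simp only [h.trace_mul, _root_.add_apply, inner_add_right]
  exact (h.summable_inner X).tsum_add (h.summable_inner Y)

theorem trace_mul_smul (h : IsTraceRoot A S) (c : ℂ) (X : E →L[ℂ] E) :
    trace (A * (c • X)) = c * trace (A * X) := by
  simp only [h.trace_mul, _root_.smul_apply, inner_smul_right]
  exact tsum_mul_left

theorem trace_mul_sum (h : IsTraceRoot A S) {ι : Type*} (s : Finset ι) (X : ι → E →L[ℂ] E) :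
    trace (A * ∑ i ∈ s, X i) = ∑ i ∈ s, trace (A * X i) := by
  classical
  induction s using Finset.induction_on with
  | empty => simp [trace]
  | insert a s ha ih => rw [Finset.sum_insert ha, Finset.sum_insert ha, h.trace_mul_add, ih]

/-- Weierstrass test with majorant `C ‖S eᵢ‖²`. Continuity of the diagonal matrix elements suffices;
norm continuity of `D` is not required. -/
theorem continuous_trace_mul (h : IsTraceRoot A S) {Z : Type*} [TopologicalSpace Z] {D : Z → E →L[ℂ] E} {C : ℝ}
    (hC : ∀ z, ‖D z‖ ≤ C) (hD : ∀ f, Continuous fun z => inner ℂ f (D z f)) :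
    Continuous fun z => trace (A * D z) := by
  simp only [h.trace_mul]
  refine continuous_tsum (fun i => hD _) (Summable.mul_left C h.isHilbertSchmidt) fun i z => ?_
  exact (norm_inner_apply_le _ _ i).trans (mul_le_mul_of_nonneg_right (hC z) (by positivity))

end IsTraceRoot

theorem trace_sub_mul {A B S T : E →L[ℂ] E} (hA : IsTraceRoot A S) (hB : IsTraceRoot B T)
    (X : E →L[ℂ] E) : trace ((A - B) * X) = trace (A * X) - trace (B * X) := by
  simp only [trace]
  rw [← (hA.summable X).tsum_sub (hB.summable X)]
  refine tsum_congr fun i => ?_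
  rw [sub_mul, _root_.sub_apply, inner_sub_right]

omit [CompleteSpace E] in
theorem re_inner_nonneg {A : E →L[ℂ] E} (hA : 0 ≤ A) (x : E) : 0 ≤ (inner ℂ x (A x)).re :=
  ((ContinuousLinearMap.nonneg_iff_isPositive A).1 hA).re_inner_nonneg_right x

theorem summable_abs_of_isTraceClass {A : E →L[ℂ] E} (hA : IsTraceClass A) :
    Summable fun i => (inner ℂ (onb E i) (CFC.abs A (onb E i))).re := by
  have h := ENNReal.summable_toReal (ne_of_lt hA)
  exact h.congr fun i => ENNReal.toReal_ofReal (re_inner_nonneg (CFC.abs_nonneg A) _)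

theorem toReal_traceNorm (A : E →L[ℂ] E) :
    (traceNorm A).toReal = ∑' i, (inner ℂ (onb E i) (CFC.abs A (onb E i))).re := by
  rw [traceNorm, ENNReal.tsum_toReal_eq fun _ => ENNReal.ofReal_ne_top]
  exact tsum_congr fun i => ENNReal.toReal_ofReal (re_inner_nonneg (CFC.abs_nonneg A) _)

theorem IsState.exists_isTraceRoot {ρ : E →L[ℂ] E} (hρ : IsState ρ) : ∃ S, IsTraceRoot ρ S := by
  have h0 : 0 ≤ ρ := (ContinuousLinearMap.nonneg_iff_isPositive ρ).2 hρ.isPositive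
  refine NonClassicality.exists_isTraceRoot h0 ?_
  have h := summable_abs_of_isTraceClass hρ.isTraceClass
  rwa [CFC.abs_of_nonneg ρ h0] at h

/-- The Jordan decomposition `A = A⁺ - A⁻`, `|A| = A⁺ + A⁻` reduces this to the positive case;
self-adjointness takes the place of a polar decomposition. -/
theorem norm_trace_mul_le {A : E →L[ℂ] E} (hsa : IsSelfAdjoint A) (hA : IsTraceClass A)
    (X : E →L[ℂ] E) : ‖trace (A * X)‖ ≤ ‖X‖ * (traceNorm A).toReal := by
  have hs := summable_abs_of_isTraceClass hA
  have habs : A⁺ + A⁻ = CFC.abs A := CFC.posPart_add_negPart A hsa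
  have hsub : A⁺ - A⁻ = A := CFC.posPart_sub_negPart A hsa
  have hP : 0 ≤ A⁺ := CFC.posPart_nonneg A
  have hN : 0 ≤ A⁻ := CFC.negPart_nonneg A
  have hre : ∀ i, (inner ℂ (onb E i) (CFC.abs A (onb E i))).re =
      (inner ℂ (onb E i) (A⁺ (onb E i))).re + (inner ℂ (onb E i) (A⁻ (onb E i))).re := by
    intro i
    rw [← habs, _root_.add_apply, inner_add_right, Complex.add_re]
  have hsP : Summable fun i => (inner ℂ (onb E i) (A⁺ (onb E i))).re :=
    hs.of_nonneg_of_le (fun i => re_inner_nonneg hP _) fun i => by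
      linarith [hre i, re_inner_nonneg hN (onb E i)]
  have hsN : Summable fun i => (inner ℂ (onb E i) (A⁻ (onb E i))).re :=
    hs.of_nonneg_of_le (fun i => re_inner_nonneg hN _) fun i => by
      linarith [hre i, re_inner_nonneg hP (onb E i)]
  obtain ⟨S, hS⟩ := exists_isTraceRoot hP hsP
  obtain ⟨T, hT⟩ := exists_isTraceRoot hN hsN
  rw [toReal_traceNorm]
  simp only [hre]
  rw [hsP.tsum_add hsN, mul_add]
  conv_lhs => rw [← hsub]
  rw [trace_sub_mul hS hT]
  exact (norm_sub_le _ _).trans (add_le_add (hS.norm_trace_mul_le X) (hT.norm_trace_mul_le X))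

end Trace

/-! ### The symplectic form -/

section Symplectic

variable {n : ℕ}

theorem symp_eq (ξ z : PhaseSpace n) :
    symp ξ z = inner ℝ (posPart ξ) (momPart z) - inner ℝ (momPart ξ) (posPart z) := by
  simp only [symp, sigma, dotProduct, Matrix.mulVec, Fintype.sum_sum_type, Matrix.fromBlocks_apply₁₁,
    Matrix.fromBlocks_apply₁₂, Matrix.fromBlocks_apply₂₁, Matrix.fromBlocks_apply₂₂,
    PiLp.inner_apply, posPart, momPart, RCLike.inner_apply, conj_trivial, Matrix.zero_apply,
    Matrix.neg_apply, Matrix.one_apply]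
  simp [mul_comm, sub_eq_add_neg]

theorem posPart_add (ξ η : PhaseSpace n) : posPart (ξ + η) = posPart ξ + posPart η := rfl
theorem momPart_add (ξ η : PhaseSpace n) : momPart (ξ + η) = momPart ξ + momPart η := rfl
theorem posPart_neg (ξ : PhaseSpace n) : posPart (-ξ) = -posPart ξ := rfl
theorem momPart_neg (ξ : PhaseSpace n) : momPart (-ξ) = -momPart ξ := rfl

theorem symp_neg_right (ξ z : PhaseSpace n) : symp ξ (-z) = -symp ξ z := by
  simp only [symp_eq, posPart_neg, momPart_neg, inner_neg_right]; ring

theorem symp_self (ξ : PhaseSpace n) : symp ξ ξ = 0 := by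
  rw [symp_eq, real_inner_comm, sub_self]

theorem symp_neg_left (ξ z : PhaseSpace n) : symp (-ξ) z = -symp ξ z := by
  simp only [symp_eq, posPart_neg, momPart_neg, inner_neg_left]; ring

theorem symp_add_left (ξ η z : PhaseSpace n) : symp (ξ + η) z = symp ξ z + symp η z := by
  simp only [symp_eq, posPart_add, momPart_add, inner_add_left]; ring

theorem symp_sub_left (ξ η z : PhaseSpace n) : symp (ξ - η) z = symp ξ z - symp η z := by
  rw [sub_eq_add_neg, symp_add_left, symp_neg_left, sub_eq_add_neg]

theorem continuous_posPart : Continuous (posPart : PhaseSpace n → Config n) := by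
  unfold posPart; fun_prop

theorem continuous_momPart : Continuous (momPart : PhaseSpace n → Config n) := by
  unfold momPart; fun_prop

end Symplectic

/-! ### Weyl relations and weak continuity of the displacement operators -/

section Displacement

variable {n : ℕ}

theorem coeFn_displacement (ξ : PhaseSpace n) (f : Modes n) :
    displacement ξ f =ᵐ[volume] weylFun ξ f :=
  (memLp_weylFun ξ f).coeFn_toLp

theorem norm_displacement_apply (ξ : PhaseSpace n) (f : Modes n) : ‖displacement ξ f‖ = ‖f‖ :=
  (Lp.norm_toLp _ (memLp_weylFun ξ f)).trans <| by
    rw [eLpNorm_weylFun ξ (Lp.aestronglyMeasurable f), Lp.norm_def]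

theorem norm_displacement_le (ξ : PhaseSpace n) : ‖displacement ξ‖ ≤ 1 :=
  LinearIsometry.norm_toContinuousLinearMap_le _

theorem weylFun_weylFun (ξ η : PhaseSpace n) (f : Config n → ℂ) :
    weylFun ξ (weylFun η f) =
      Complex.exp (-Complex.I * ((symp ξ η / 2 : ℝ) : ℂ)) • weylFun (ξ + η) f := by
  funext x
  simp only [weylFun, weylPhase, Pi.smul_apply, smul_eq_mul, ← mul_assoc, ← Complex.exp_add,
    posPart_add, add_assoc]
  congr 2
  rw [symp_eq, momPart_add, inner_add_left, inner_add_left, inner_add_right, inner_add_right,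
    inner_add_right, real_inner_comm (momPart ξ) (posPart η),
    real_inner_comm (posPart ξ) (momPart η)]
  push_cast
  ring

theorem displacement_mul (ξ η : PhaseSpace n) :
    displacement ξ * displacement η =
      Complex.exp (-Complex.I * ((symp ξ η / 2 : ℝ) : ℂ)) • displacement (ξ + η) := by
  ext1 f
  rw [mul_apply_eq_comp, _root_.smul_apply]
  refine Lp.ext ?_
  refine (coeFn_displacement ξ _).trans ((weylFun_congr ξ (coeFn_displacement η f)).trans ?_)
  rw [weylFun_weylFun]
  filter_upwards [Lp.coeFn_smul (Complex.exp (-Complex.I * ((symp ξ η / 2 : ℝ) : ℂ)))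
    (displacement (ξ + η) f), coeFn_displacement (ξ + η) f] with x h1 h2
  rw [h1, Pi.smul_apply, Pi.smul_apply, h2]

theorem displacement_zero : displacement (0 : PhaseSpace n) = 1 := by
  ext1 f
  refine Lp.ext ((coeFn_displacement 0 f).trans (Filter.Eventually.of_forall fun x => ?_))
  have h1 : posPart (0 : PhaseSpace n) = 0 := rfl
  have h2 : momPart (0 : PhaseSpace n) = 0 := rfl
  simp [weylFun, weylPhase, h1, h2]

/-- An isometry has its adjoint as left inverse, while the Weyl relation makes `D(-ξ)` a right
inverse because `ξ · σ ξ = 0`; the two must agree. -/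
theorem star_displacement (ξ : PhaseSpace n) : star (displacement ξ) = displacement (-ξ) := by
  have h1 : star (displacement ξ) * displacement ξ = 1 :=
    (ContinuousLinearMap.norm_map_iff_adjoint_comp_self _).1 (norm_displacement_apply ξ)
  have h2 : displacement ξ * displacement (-ξ) = 1 := by
    rw [displacement_mul, symp_neg_right, symp_self, add_neg_cancel, displacement_zero]
    simp
  exact left_inv_eq_right_inv h1 h2

/-- The phase is exactly the one in the Bochner matrix with parameter `1`. -/
theorem displacement_mul_star (ξ η : PhaseSpace n) :
    displacement ξ * star (displacement η) =
      Complex.exp (Complex.I * ((symp ξ η / 2 : ℝ) : ℂ)) • displacement (ξ - η) := by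
  rw [star_displacement, displacement_mul, symp_neg_right, sub_eq_add_neg]
  push_cast
  ring_nf

/-- The phase space vector `(a, 0)`. -/
noncomputable def ofPos (a : Config n) : PhaseSpace n := WithLp.toLp 2 (Sum.elim a 0)

/-- The phase space vector `(0, b)`. -/
noncomputable def ofMom (b : Config n) : PhaseSpace n := WithLp.toLp 2 (Sum.elim 0 b)

theorem ofMom_add_ofPos (ξ : PhaseSpace n) : ofMom (momPart ξ) + ofPos (posPart ξ) = ξ := by
  ext i
  rcases i with i | i <;> simp [ofMom, ofPos, momPart, posPart]

/-- Separates modulation from translation, so that the continuity of each factor can be treated on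
its own. -/
theorem displacement_eq_mul (ξ : PhaseSpace n) :
    displacement ξ = Complex.exp (-Complex.I * ((inner ℝ (momPart ξ) (posPart ξ) / 2 : ℝ) : ℂ)) •
      (displacement (ofMom (momPart ξ)) * displacement (ofPos (posPart ξ))) := by
  have h1 : ∀ b : Config n, posPart (ofMom b) = 0 := fun b => rfl
  have h2 : ∀ a : Config n, momPart (ofPos a) = 0 := fun b => rfl
  have h3 : ∀ b : Config n, momPart (ofMom b) = b := fun b => rfl
  have h4 : ∀ a : Config n, posPart (ofPos a) = a := fun b => rfl
  rw [displacement_mul, smul_smul, ← Complex.exp_add, ofMom_add_ofPos, symp_eq, h1, h2, h3, h4,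
    inner_zero_left]
  push_cast
  ring_nf
  simp

theorem continuous_displacement_ofPos_apply (f : Modes n) :
    Continuous fun a : Config n => displacement (ofPos a) f := by
  have h : Continuous fun a : Config n =>
      Lp.compMeasurePreserving (fun x => x + a) (measurePreserving_shift a) f :=
    Continuous.compMeasurePreservingLp (f := fun _ => f)
      (g := fun a : Config n => (⟨fun x => x + a, by fun_prop⟩ : C(Config n, Config n)))
      continuous_const (ContinuousMap.continuous_of_continuous_uncurry _
        (show Continuous fun y : Config n × Config n => y.2 + y.1 by fun_prop))
      measurePreserving_shift ENNReal.ofNat_ne_top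
  refine h.congr fun a => Lp.ext ?_
  refine (Lp.coeFn_compMeasurePreserving f _).trans (Filter.EventuallyEq.trans ?_
    (coeFn_displacement (ofPos a) f).symm)
  have h1 : posPart (ofPos a) = a := rfl
  have h2 : momPart (ofPos a) = 0 := rfl
  exact Filter.Eventually.of_forall fun x => by simp [weylFun, weylPhase, h1, h2]

theorem continuous_inner_displacement_ofMom (h f : Modes n) :
    Continuous fun b : Config n => inner ℂ h (displacement (ofMom b) f) := by
  have h1 : ∀ b : Config n, posPart (ofMom b) = 0 := fun b => rfl
  have h2 : ∀ b : Config n, momPart (ofMom b) = b := fun b => rfl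
  have key : ∀ b : Config n, inner ℂ h (displacement (ofMom b) f) =
      ∫ x, Complex.exp (-Complex.I * ((inner ℝ b x : ℝ) : ℂ)) * f x * conj (h x) := by
    intro b
    rw [L2.inner_def]
    refine integral_congr_ae ?_
    filter_upwards [coeFn_displacement (ofMom b) f] with x hx
    rw [hx]
    simp [weylFun, weylPhase, h1, h2]
  simp only [key]
  refine continuous_of_dominated (bound := fun x => ‖f x‖ * ‖h x‖) (fun b => ?_) (fun b => ?_) ?_ ?_
  · have hc : Continuous fun x : Config n =>
        Complex.exp (-Complex.I * ((inner ℝ b x : ℝ) : ℂ)) := by fun_prop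
    exact (hc.aestronglyMeasurable.mul (Lp.aestronglyMeasurable f)).mul
      (Complex.continuous_conj.comp_aestronglyMeasurable (Lp.aestronglyMeasurable h))
  · refine Filter.Eventually.of_forall fun x => ?_
    rw [norm_mul, norm_mul, RCLike.norm_conj, neg_mul, ← mul_neg, mul_comm Complex.I,
      ← Complex.ofReal_neg, Complex.norm_exp_ofReal_mul_I, one_mul]
  · exact (Lp.memLp f).norm.integrable_mul (Lp.memLp h).norm
  · refine Filter.Eventually.of_forall fun x => ?_
    fun_prop

theorem continuous_inner_displacement (h f : Modes n) :
    Continuous fun ξ : PhaseSpace n => inner ℂ h (displacement ξ f) := by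
  have hv : Continuous fun ξ : PhaseSpace n => displacement (ofPos (posPart ξ)) f :=
    (continuous_displacement_ofPos_apply f).comp continuous_posPart
  have key : Continuous fun ξ : PhaseSpace n =>
      inner ℂ h (displacement (ofMom (momPart ξ)) (displacement (ofPos (posPart ξ)) f)) := by
    rw [continuous_iff_continuousAt]
    intro ξ₀
    set v := displacement (ofPos (posPart ξ₀)) f with hv₀
    -- The translated vector is frozen at `ξ₀`; the error is controlled uniformly in the modulation,
    -- which is isometric.
    have e1 : Filter.Tendsto (fun ξ : PhaseSpace n => inner ℂ h
        (displacement (ofMom (momPart ξ)) (displacement (ofPos (posPart ξ)) f - v)))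
        (nhds ξ₀) (nhds 0) := by
      have e2 : Filter.Tendsto (fun ξ : PhaseSpace n =>
          ‖h‖ * ‖displacement (ofPos (posPart ξ)) f - v‖) (nhds ξ₀) (nhds 0) := by
        have e3 : Continuous fun ξ : PhaseSpace n =>
          ‖h‖ * ‖displacement (ofPos (posPart ξ)) f - v‖ := by fun_prop
        simpa [hv₀] using e3.tendsto ξ₀
      refine squeeze_zero_norm (fun ξ => ?_) e2
      refine (norm_inner_le_norm _ _).trans_eq ?_
      rw [norm_displacement_apply]
    have e4 := (((continuous_inner_displacement_ofMom h v).comp continuous_momPart).tendsto ξ₀)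
    have e5 := e1.add e4
    simp only [Function.comp_apply, zero_add] at e5
    refine e5.congr fun ξ => ?_
    rw [map_sub, inner_sub_right, sub_add_cancel]
  have hp := continuous_posPart (n := n)
  have hm := continuous_momPart (n := n)
  have hc : Continuous fun ξ : PhaseSpace n =>
      Complex.exp (-Complex.I * ((inner ℝ (momPart ξ) (posPart ξ) / 2 : ℝ) : ℂ)) := by fun_prop
  refine (hc.mul key).congr fun ξ => ?_
  conv_rhs => rw [displacement_eq_mul ξ]
  rw [_root_.smul_apply, mul_apply_eq_comp, inner_smul_right]
  rfl

end Displacement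

/-! ### Modulated Gaussians as Schwartz functions -/

section Gaussian

theorem iteratedDeriv_cexp_mul_ofReal (c : ℂ) (k : ℕ) :
    iteratedDeriv k (fun t : ℝ => Complex.exp (c * t)) =
      fun t : ℝ => c ^ k * Complex.exp (c * t) := by
  induction k with
  | zero => simp
  | succ k ih =>
    rw [iteratedDeriv_succ, ih]
    funext t
    have h : HasDerivAt (fun t : ℝ => Complex.exp (c * t)) (Complex.exp (c * t) * (c * 1)) t :=
      ((Complex.ofRealCLM.hasDerivAt (x := t)).const_mul c).cexp
    rw [(h.const_mul (c ^ k)).deriv]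
    ring

theorem contDiff_cexp_mul_ofReal (c : ℂ) {N : WithTop ℕ∞} :
    ContDiff ℝ N fun t : ℝ => Complex.exp (c * t) :=
  (contDiff_const.mul Complex.ofRealCLM.contDiff).cexp

theorem norm_iteratedFDeriv_cexp_mul_ofReal (c : ℂ) (k : ℕ) (t : ℝ) :
    ‖iteratedFDeriv ℝ k (fun t : ℝ => Complex.exp (c * t)) t‖ =
      ‖c‖ ^ k * ‖Complex.exp (c * t)‖ := by
  rw [norm_iteratedFDeriv_eq_norm_iteratedDeriv, iteratedDeriv_cexp_mul_ofReal, norm_mul, norm_pow]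

theorem hasTemperateGrowth_cexp_I_mul :
    Function.HasTemperateGrowth fun t : ℝ => Complex.exp (Complex.I * t) := by
  refine ⟨contDiff_cexp_mul_ofReal _, fun k => ⟨0, 1, fun t => ?_⟩⟩
  rw [norm_iteratedFDeriv_cexp_mul_ofReal, mul_comm Complex.I, Complex.norm_exp_ofReal_mul_I]
  simp

theorem exists_pow_mul_exp_neg_mul_sq_le {b : ℝ} (hb : 0 < b) (N : ℕ) :
    ∃ C : ℝ, ∀ r : ℝ, 0 ≤ r → (1 + r) ^ N * Real.exp (-b * r ^ 2) ≤ C := by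
  -- From `-b r² ≤ b - (b/2)(1 + r)` the Gaussian decays at least exponentially; then `y ^ N / N! ≤
  -- exp y` at `y = (b/2)(1 + r)` absorbs the power.
  refine ⟨Real.exp b * (N.factorial / (b / 2) ^ N), fun r hr => ?_⟩
  have h1 : Real.exp (-b * r ^ 2) ≤ Real.exp b * Real.exp (-(b / 2 * (1 + r))) := by
    rw [← Real.exp_add]
    refine Real.exp_le_exp.2 ?_
    nlinarith [mul_nonneg hb.le (sq_nonneg (r - 1)), mul_nonneg hb.le hr]
  have h2 : (b / 2 * (1 + r)) ^ N / N.factorial ≤ Real.exp (b / 2 * (1 + r)) :=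
    Real.pow_div_factorial_le_exp _ (by positivity) N
  have h3 : (1 + r) ^ N * Real.exp (-(b / 2 * (1 + r))) ≤ N.factorial / (b / 2) ^ N := by
    rw [Real.exp_neg, ← div_eq_mul_inv, div_le_div_iff₀ (Real.exp_pos _) (by positivity)]
    rw [div_le_iff₀ (by positivity), mul_pow] at h2
    linarith
  calc (1 + r) ^ N * Real.exp (-b * r ^ 2)
      ≤ (1 + r) ^ N * (Real.exp b * Real.exp (-(b / 2 * (1 + r)))) := by gcongr
    _ = Real.exp b * ((1 + r) ^ N * Real.exp (-(b / 2 * (1 + r)))) := by ring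
    _ ≤ _ := by gcongr

variable {V : Type*} [NormedAddCommGroup V] [InnerProductSpace ℝ V]

theorem contDiff_cexp_neg_mul_norm_sq (b : ℝ) {N : WithTop ℕ∞} :
    ContDiff ℝ N fun x : V => Complex.exp (-(b : ℂ) * ((‖x‖ ^ 2 : ℝ) : ℂ)) :=
  (contDiff_cexp_mul_ofReal (-(b : ℂ))).comp (contDiff_norm_sq ℝ)

/-- A Faà di Bruno estimate for `t ↦ exp (-b t)` composed with `‖x‖²`: the inner derivatives grow
polynomially, the outer ones keep the Gaussian factor. -/
theorem exists_norm_iteratedFDeriv_gaussian_le {b : ℝ} (hb : 0 < b) (k n : ℕ) :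
    ∃ C : ℝ, ∀ x : V, ‖x‖ ^ k *
      ‖iteratedFDeriv ℝ n (fun x : V => Complex.exp (-(b : ℂ) * ((‖x‖ ^ 2 : ℝ) : ℂ))) x‖ ≤ C := by
  obtain ⟨K, C₀, hC₀, hK⟩ :=
    (Function.hasTemperateGrowth_norm_sq (H := V)).norm_iteratedFDeriv_le_uniform n
  obtain ⟨C₁, hC₁⟩ := exists_pow_mul_exp_neg_mul_sq_le hb (k + K * n)
  refine ⟨n.factorial * (1 + b) ^ n * (C₀ + 1) ^ n * C₁, fun x => ?_⟩
  have hg : ∀ i ≤ n, ‖iteratedFDeriv ℝ i (fun t : ℝ => Complex.exp (-(b : ℂ) * t)) (‖x‖ ^ 2)‖ ≤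
      (1 + b) ^ n * Real.exp (-b * ‖x‖ ^ 2) := by
    intro i hi
    rw [norm_iteratedFDeriv_cexp_mul_ofReal, Complex.norm_exp, norm_neg, Complex.norm_real,
      Real.norm_of_nonneg hb.le]
    have e : (-(b : ℂ) * ((‖x‖ ^ 2 : ℝ) : ℂ)).re = -b * ‖x‖ ^ 2 := by
      rw [← Complex.ofReal_neg, ← Complex.ofReal_mul, Complex.ofReal_re]
    rw [e]
    gcongr
    exact (pow_le_pow_left₀ hb.le (by linarith) i).trans (pow_le_pow_right₀ (by linarith) hi)
  have hx : (1 : ℝ) ≤ 1 + ‖x‖ := by linarith [norm_nonneg x]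
  -- The composition estimate wants a bound of the form `D ^ i`; taking `C₀ + 1` instead of `C₀`
  -- makes the base at least `1`, so that `D ≤ D ^ i`.
  have hf : ∀ i, 1 ≤ i → i ≤ n → ‖iteratedFDeriv ℝ i (fun x : V => ‖x‖ ^ 2) x‖ ≤
      ((C₀ + 1) * (1 + ‖x‖) ^ K) ^ i := by
    intro i hi hin
    have h1 : (1 : ℝ) ≤ (C₀ + 1) * (1 + ‖x‖) ^ K :=
      one_le_mul_of_one_le_of_one_le (by linarith) (one_le_pow₀ hx)
    refine ((hK i hin x).trans ?_).trans (le_self_pow₀ h1 (by omega))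
    gcongr
    linarith
  have h := norm_iteratedFDeriv_comp_le (contDiff_cexp_mul_ofReal (-(b : ℂ)) (N := (n : ℕ∞)))
    (contDiff_norm_sq ℝ (E := V) (n := ((n : ℕ∞) : WithTop ℕ∞))) le_rfl x hg hf
  calc ‖x‖ ^ k * _
      ≤ (1 + ‖x‖) ^ k * (n.factorial * ((1 + b) ^ n * Real.exp (-b * ‖x‖ ^ 2)) *
          ((C₀ + 1) * (1 + ‖x‖) ^ K) ^ n) := by
        refine mul_le_mul (pow_le_pow_left₀ (norm_nonneg _) (by linarith) k) h (norm_nonneg _)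
          (by positivity)
    _ = n.factorial * (1 + b) ^ n * (C₀ + 1) ^ n *
          ((1 + ‖x‖) ^ (k + K * n) * Real.exp (-b * ‖x‖ ^ 2)) := by
        rw [pow_add, pow_mul, mul_pow]; ring
    _ ≤ _ := by
        gcongr
        exact hC₁ _ (norm_nonneg x)

/-- The Gaussian `x ↦ exp (-b ‖x‖²)` as a Schwartz function. -/
noncomputable def gaussianSchwartz (V : Type*) [NormedAddCommGroup V] [InnerProductSpace ℝ V]
    {b : ℝ} (hb : 0 < b) : 𝓢(V, ℂ) where
  toFun x := Complex.exp (-(b : ℂ) * ((‖x‖ ^ 2 : ℝ) : ℂ))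
  smooth' := contDiff_cexp_neg_mul_norm_sq b
  decay' := exists_norm_iteratedFDeriv_gaussian_le hb

/-- The modulated Gaussian `x ↦ exp (i ⟨w, x⟩) exp (-b ‖x‖²)` as a Schwartz function. -/
noncomputable def modulatedGaussian (w : V) {b : ℝ} (hb : 0 < b) : 𝓢(V, ℂ) :=
  SchwartzMap.smulLeftCLM ℂ (fun x : V => Complex.exp (Complex.I * (inner ℝ w x : ℝ)))
    (gaussianSchwartz V hb)

theorem modulatedGaussian_apply (w : V) {b : ℝ} (hb : 0 < b) (x : V) :
    modulatedGaussian w hb x = Complex.exp (Complex.I * (inner ℝ w x : ℝ)) *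
      Complex.exp (-(b : ℂ) * ((‖x‖ ^ 2 : ℝ) : ℂ)) := by
  have h : Function.HasTemperateGrowth
      fun x : V => Complex.exp (Complex.I * (inner ℝ w x : ℝ)) :=
    hasTemperateGrowth_cexp_I_mul.comp (innerSL ℝ w).hasTemperateGrowth
  rw [modulatedGaussian, SchwartzMap.smulLeftCLM_apply_apply h, smul_eq_mul]
  rfl

theorem integral_modulatedGaussian [FiniteDimensional ℝ V] [MeasurableSpace V] [BorelSpace V]
    (w : V) {b : ℝ} (hb : 0 < b) :
    ∫ x, modulatedGaussian w hb x =
      (Real.pi / b : ℂ) ^ (Module.finrank ℝ V / 2 : ℂ) *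
        Complex.exp (-((‖w‖ ^ 2 / (4 * b) : ℝ) : ℂ)) := by
  have h := GaussianFourier.integral_cexp_neg_mul_sq_norm_add (b := (b : ℂ)) (by simpa using hb)
    Complex.I w
  have e : -((‖w‖ ^ 2 / (4 * b) : ℝ) : ℂ) = Complex.I ^ 2 * ‖w‖ ^ 2 / (4 * b) := by
    rw [Complex.I_sq]; push_cast; ring
  rw [e, ← h]
  refine integral_congr_ae (Filter.Eventually.of_forall fun x => ?_)
  simp only [modulatedGaussian_apply, ← Complex.exp_add]
  push_cast
  ring_nf

end Gaussian

/-! ### Bochner's theorem for the symplectic Fourier transform -/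

section Bochner

variable {n : ℕ}

theorem symp_swap (ξ z : PhaseSpace n) : symp z ξ = -symp ξ z := by
  rw [symp_eq, symp_eq, real_inner_comm (posPart ξ), real_inner_comm (momPart ξ)]; ring

/-- The vector `σᵀ ξ`, which represents the functional `ξ · σ`. -/
noncomputable def sympVec (ξ : PhaseSpace n) : PhaseSpace n :=
  WithLp.toLp 2 (Sum.elim (-momPart ξ) (posPart ξ))

theorem inner_sympVec (ξ z : PhaseSpace n) : inner ℝ (sympVec ξ) z = symp ξ z := by
  rw [symp_eq]
  simp [sympVec, PiLp.inner_apply, posPart, momPart, add_comm, sub_eq_add_neg]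

theorem norm_sympVec (ξ : PhaseSpace n) : ‖sympVec ξ‖ = ‖ξ‖ := by
  simp [sympVec, EuclideanSpace.norm_eq, posPart, momPart, add_comm]

/-- The two phases merge into the modulation by `sympVec (η - ξ)`, which has norm `‖ξ - η‖`. Hence
these test functions localize `χ` around `η`. -/
theorem integral_exp_symp_mul_modulatedGaussian (ξ η : PhaseSpace n) {b : ℝ} (hb : 0 < b) :
    ∫ z, Complex.exp (-Complex.I * (symp ξ z : ℂ)) * modulatedGaussian (sympVec η) hb z =
      (((Real.pi / b) ^ n * Real.exp (-(‖ξ - η‖ ^ 2 / (4 * b))) : ℝ) : ℂ) := by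
  have h := integral_modulatedGaussian (sympVec (η - ξ)) hb
  have hdim : (Module.finrank ℝ (PhaseSpace n) / 2 : ℂ) = (n : ℕ) := by
    rw [finrank_euclideanSpace, Fintype.card_sum, Fintype.card_fin]
    push_cast
    ring
  rw [hdim, Complex.cpow_natCast, norm_sympVec, norm_sub_rev] at h
  push_cast at h ⊢
  rw [← h]
  refine integral_congr_ae (Filter.Eventually.of_forall fun z => ?_)
  simp only [modulatedGaussian_apply, ← Complex.exp_add, inner_sympVec, symp_sub_left]
  push_cast
  ring_nf

/-- Substituting `ξ = η + s u` produces `s ^ (2n)`, which cancels the normalization `(π / s²) ^ n`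
up to `π ^ n`. The prefactor is then free of `s`, and the limit `s → 0` can be taken. -/
theorem integral_mul_gaussian_scale (χ : PhaseSpace n → ℂ) (η : PhaseSpace n) {s : ℝ}
    (hs : 0 < s) :
    ∫ ξ, χ ξ * (((2 * Real.pi : ℂ) ^ (2 * n))⁻¹ * ∫ z, Complex.exp (-Complex.I * (symp ξ z : ℂ)) *
        modulatedGaussian (sympVec η) (sq_pos_of_pos hs) z) =
      (((2 * Real.pi) ^ (2 * n))⁻¹ * Real.pi ^ n : ℝ) *
        ∫ u, χ (η + s • u) * (Real.exp (-(‖u‖ ^ 2 / 4)) : ℂ) := by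
  simp only [integral_exp_symp_mul_modulatedGaussian]
  have hdim : Module.finrank ℝ (PhaseSpace n) = 2 * n := by
    rw [finrank_euclideanSpace, Fintype.card_sum, Fintype.card_fin, two_mul]
  set F : PhaseSpace n → ℂ := fun ζ => χ (η + ζ) * (Real.exp (-(‖ζ‖ ^ 2 / (4 * s ^ 2))) : ℂ)
    with hF
  have h1 : ∫ ξ, χ ξ * (((2 * Real.pi : ℂ) ^ (2 * n))⁻¹ *
      (((Real.pi / s ^ 2) ^ n * Real.exp (-(‖ξ - η‖ ^ 2 / (4 * s ^ 2))) : ℝ) : ℂ)) =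
      (((2 * Real.pi) ^ (2 * n))⁻¹ * (Real.pi / s ^ 2) ^ n : ℝ) * ∫ ζ, F ζ := by
    rw [← integral_sub_right_eq_self F η, ← integral_const_mul]
    refine integral_congr_ae (Filter.Eventually.of_forall fun ξ => ?_)
    simp only [hF, add_sub_cancel]
    push_cast
    ring
  have h2 : ∫ u, χ (η + s • u) * (Real.exp (-(‖u‖ ^ 2 / 4)) : ℂ) = ∫ u, F (s • u) := by
    refine integral_congr_ae (Filter.Eventually.of_forall fun u => ?_)
    simp only [hF, norm_smul, mul_pow, Real.norm_eq_abs, sq_abs]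
    congr 4
    field_simp
  rw [h1, h2, Measure.integral_comp_smul_of_nonneg volume F s (hR := hs.le), hdim,
    Complex.real_smul, ← mul_assoc]
  congr 1
  push_cast
  rw [div_pow, pow_mul]
  ring

theorem integrable_exp_neg_norm_sq_div_four :
    Integrable fun u : PhaseSpace n => Real.exp (-(‖u‖ ^ 2 / 4)) := by
  have h := ((gaussianSchwartz (PhaseSpace n) (b := 1 / 4) (by norm_num)).integrable
    (μ := volume)).norm
  refine h.congr (Filter.Eventually.of_forall fun u => ?_)
  change ‖Complex.exp (-((1 / 4 : ℝ) : ℂ) * ((‖u‖ ^ 2 : ℝ) : ℂ))‖ = _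
  rw [← Complex.ofReal_neg, ← Complex.ofReal_mul, Complex.norm_exp_ofReal]
  ring_nf

theorem continuous_integral_mul_gaussian {χ : PhaseSpace n → ℂ} (hχ : Continuous χ) {C : ℝ}
    (hC : ∀ ξ, ‖χ ξ‖ ≤ C) (η : PhaseSpace n) :
    Continuous fun s : ℝ =>
      ∫ u : PhaseSpace n, χ (η + s • u) * (Real.exp (-(‖u‖ ^ 2 / 4)) : ℂ) := by
  refine continuous_of_dominated (bound := fun u => C * Real.exp (-(‖u‖ ^ 2 / 4)))
    (fun s => ?_) (fun s => ?_) (integrable_exp_neg_norm_sq_div_four.const_mul C) ?_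
  · exact Continuous.aestronglyMeasurable (by fun_prop)
  · refine Filter.Eventually.of_forall fun u => ?_
    rw [norm_mul, Complex.norm_real, Real.norm_of_nonneg (Real.exp_pos _).le]
    gcongr
    exact hC _
  · exact Filter.Eventually.of_forall fun u => by fun_prop

theorem sum_conj_mul_mul_exp_eq {m : ℕ} (T : Fin m → PhaseSpace n) (c : Fin m → ℂ)
    (z : PhaseSpace n) :
    ∑ k, ∑ l, conj (c k) * c l * Complex.exp (Complex.I * (symp (T k - T l) z : ℝ)) =
      ((‖∑ k, conj (c k) * Complex.exp (Complex.I * (symp (T k) z : ℝ))‖ ^ 2 : ℝ) : ℂ) := by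
  rw [Complex.ofReal_pow, ← Complex.mul_conj', map_sum, Finset.sum_mul_sum]
  refine Finset.sum_congr rfl fun k _ => Finset.sum_congr rfl fun l _ => ?_
  rw [map_mul, Complex.conj_conj, ← Complex.exp_conj, map_mul, Complex.conj_I, Complex.conj_ofReal,
    symp_sub_left, mul_mul_mul_comm, ← Complex.exp_add]
  push_cast
  ring_nf

/-- **Bochner's theorem**, easy direction: a bounded continuous function whose symplectic Fourier
transform is a nonnegative square integrable function is positive definite. -/
theorem sum_conj_mul_mul_nonneg {χ : PhaseSpace n → ℂ} (hχ : Continuous χ) {C : ℝ}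
    (hC : ∀ ξ, ‖χ ξ‖ ≤ C) {W : PhaseSpace n → ℝ} (hW : MemLp W 2 volume) (hW0 : ∀ᵐ z, 0 ≤ W z)
    (hF : ∀ φ : 𝓢(PhaseSpace n, ℂ), ∫ z, (W z : ℂ) * φ z = ∫ ξ, χ ξ *
      (((2 * Real.pi : ℂ) ^ (2 * n))⁻¹ * ∫ z, Complex.exp (-Complex.I * (symp ξ z : ℂ)) * φ z))
    {m : ℕ} (T : Fin m → PhaseSpace n) (c : Fin m → ℂ) :
    0 ≤ ∑ k, ∑ l, conj (c k) * c l * χ (T k - T l) := by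
  set κ : ℝ := ((2 * Real.pi) ^ (2 * n))⁻¹ * Real.pi ^ n with hκ
  have hκ0 : 0 < κ := by positivity
  set R : PhaseSpace n → ℝ → ℂ := fun η s =>
    ∫ u : PhaseSpace n, χ (η + s • u) * (Real.exp (-(‖u‖ ^ 2 / 4)) : ℂ) with hR
  -- At positive `s` the sum is the integral of `W` against a squared modulus times the Gaussian
  -- `exp (-s² ‖z‖²)`, hence nonnegative.
  have hpos : ∀ s : ℝ, 0 < s →
      0 ≤ (κ : ℂ) * ∑ k, ∑ l, conj (c k) * c l * R (T k - T l) s := by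
    intro s hs
    -- A product of two square integrable functions; this licenses exchanging the finite sums with
    -- the integral.
    have hint : ∀ η : PhaseSpace n, Integrable fun z : PhaseSpace n =>
        (W z : ℂ) * modulatedGaussian (sympVec η) (sq_pos_of_pos hs) z := fun η =>
      hW.ofReal.integrable_mul ((modulatedGaussian (sympVec η) (sq_pos_of_pos hs)).memLp 2 volume)
    have e : (κ : ℂ) * ∑ k, ∑ l, conj (c k) * c l * R (T k - T l) s =
        ∫ z, ((W z * (‖∑ k, conj (c k) * Complex.exp (Complex.I * (symp (T k) z : ℝ))‖ ^ 2 *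
          Real.exp (-(s ^ 2) * ‖z‖ ^ 2)) : ℝ) : ℂ) := by
      calc (κ : ℂ) * ∑ k, ∑ l, conj (c k) * c l * R (T k - T l) s
          = ∑ k, ∑ l, conj (c k) * c l * ∫ z, (W z : ℂ) *
              modulatedGaussian (sympVec (T k - T l)) (sq_pos_of_pos hs) z := by
            simp only [hF, fun η => integral_mul_gaussian_scale χ η hs, Finset.mul_sum]
            refine Finset.sum_congr rfl fun k _ => Finset.sum_congr rfl fun l _ => ?_
            simp only [hR, hκ]
            ring
        _ = ∫ z, ∑ k, ∑ l, conj (c k) * c l * ((W z : ℂ) *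
              modulatedGaussian (sympVec (T k - T l)) (sq_pos_of_pos hs) z) := by
            rw [integral_finsetSum _ fun k _ => integrable_finsetSum _ fun l _ =>
              (hint _).const_mul _]
            refine Finset.sum_congr rfl fun k _ => ?_
            rw [integral_finsetSum _ fun l _ => (hint _).const_mul _]
            exact Finset.sum_congr rfl fun l _ => (integral_const_mul _ _).symm
        _ = _ := by
            refine integral_congr_ae (Filter.Eventually.of_forall fun z => ?_)
            dsimp only
            rw [Complex.ofReal_mul, Complex.ofReal_mul, ← sum_conj_mul_mul_exp_eq, Finset.sum_mul,
              Finset.mul_sum]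
            refine Finset.sum_congr rfl fun k _ => ?_
            rw [Finset.sum_mul, Finset.mul_sum]
            refine Finset.sum_congr rfl fun l _ => ?_
            rw [modulatedGaussian_apply, inner_sympVec]
            push_cast
            ring
    rw [e, integral_complex_ofReal, Complex.zero_le_real]
    refine integral_nonneg_of_ae ?_
    filter_upwards [hW0] with z hz
    exact mul_nonneg hz (by positivity)
  have hcont : Continuous fun s : ℝ => (κ : ℂ) * ∑ k, ∑ l, conj (c k) * c l * R (T k - T l) s :=
    continuous_const.mul (continuous_finsetSum _ fun k _ => continuous_finsetSum _ fun l _ =>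
      continuous_const.mul (continuous_integral_mul_gaussian hχ hC _))
  -- As `s → 0⁺`, `R η s` tends to `χ η` times the positive Gaussian mass `G`, and nonnegativity
  -- passes to the limit.
  have hlim := (hcont.tendsto 0).mono_left (nhdsWithin_le_nhds (s := Set.Ioi (0 : ℝ)))
  have h0 := ge_of_tendsto hlim (by filter_upwards [self_mem_nhdsWithin] with s hs using hpos s hs)
  set G : ℝ := ∫ u : PhaseSpace n, Real.exp (-(‖u‖ ^ 2 / 4)) with hG
  have hG0 : 0 < G := integral_exp_pos integrable_exp_neg_norm_sq_div_four
  have hR0 : ∀ η, R η 0 = χ η * G := fun η => by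
    simp only [hR, zero_smul, add_zero]
    rw [integral_const_mul, integral_complex_ofReal]
  have h1 : (κ : ℂ) * ∑ k, ∑ l, conj (c k) * c l * R (T k - T l) 0 =
      ((κ * G : ℝ) : ℂ) * ∑ k, ∑ l, conj (c k) * c l * χ (T k - T l) := by
    simp only [hR0, Finset.mul_sum]
    refine Finset.sum_congr rfl fun k _ => Finset.sum_congr rfl fun l _ => ?_
    push_cast
    ring
  rw [h1] at h0
  have hκG : 0 < κ * G := mul_pos hκ0 hG0
  have h2 := mul_nonneg (Complex.zero_le_real.2 (inv_nonneg.2 hκG.le)) h0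
  rwa [← mul_assoc, ← Complex.ofReal_mul, inv_mul_cancel₀ hκG.ne', Complex.ofReal_one,
    one_mul] at h2

end Bochner

/-! ### Bochner matrices and feasibility -/

section BochnerMatrix

variable {n m : ℕ}

theorem isHermitian_bochnerMatrix (r : ℝ) {χ : PhaseSpace n → ℂ} (hχ : ∀ ξ, χ (-ξ) = conj (χ ξ))
    (T : Fin m → PhaseSpace n) : (bochnerMatrix r χ T).IsHermitian := by
  ext k l
  simp only [bochnerMatrix, Matrix.conjTranspose_apply, Matrix.of_apply]
  rw [← neg_sub, hχ, star_mul', Complex.star_def, Complex.conj_conj,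
    ← Complex.exp_conj, map_mul, Complex.conj_I, Complex.conj_ofReal, symp_swap (T k) (T l)]
  push_cast
  ring_nf

theorem star_dotProduct_mulVec (A : Matrix (Fin m) (Fin m) ℂ) (c : Fin m → ℂ) :
    star c ⬝ᵥ (A *ᵥ c) = ∑ k, ∑ l, conj (c k) * c l * A k l := by
  simp only [dotProduct, Matrix.mulVec, Pi.star_apply, Complex.star_def, Finset.mul_sum]
  refine Finset.sum_congr rfl fun k _ => Finset.sum_congr rfl fun l _ => ?_
  ring

/-- A Hermitian `m × m` matrix with entries bounded by `t` has smallest eigenvalue at least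
`-t m`. -/
theorem posSemidef_add_smul_one {A : Matrix (Fin m) (Fin m) ℂ} (hA : A.IsHermitian) {t : ℝ}
    (ht : 0 ≤ t) (hAt : ∀ k l, ‖A k l‖ ≤ t) :
    (A + ((t * m : ℝ) : ℂ) • (1 : Matrix (Fin m) (Fin m) ℂ)).PosSemidef := by
  have hH : (A + ((t * m : ℝ) : ℂ) • (1 : Matrix (Fin m) (Fin m) ℂ)).IsHermitian := by
    refine hA.add ?_
    rw [Matrix.IsHermitian, Matrix.conjTranspose_smul, Matrix.conjTranspose_one, Complex.star_def,
      Complex.conj_ofReal]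
  refine Matrix.PosSemidef.of_dotProduct_mulVec_nonneg hH fun c => ?_
  rw [Complex.nonneg_iff]
  refine ⟨?_, (hH.im_star_dotProduct_mulVec_self c).symm⟩
  have h1 : ‖star c ⬝ᵥ (A *ᵥ c)‖ ≤ t * m * ∑ k, ‖c k‖ ^ 2 := by
    rw [star_dotProduct_mulVec]
    calc ‖∑ k, ∑ l, conj (c k) * c l * A k l‖ ≤ ∑ k, ∑ l, ‖c k‖ * ‖c l‖ * t := by
          refine norm_sum_le_of_le _ fun k _ => norm_sum_le_of_le _ fun l _ => ?_
          rw [norm_mul, norm_mul, RCLike.norm_conj]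
          gcongr
          exact hAt k l
      _ = t * (∑ k, ‖c k‖) ^ 2 := by
          rw [sq, Finset.sum_mul_sum, Finset.mul_sum]
          refine Finset.sum_congr rfl fun k _ => ?_
          rw [Finset.mul_sum]
          exact Finset.sum_congr rfl fun l _ => mul_comm _ _
      -- Cauchy–Schwarz on the `m` coordinates is the source of the factor `m` in the program.
      _ ≤ t * (m * ∑ k, ‖c k‖ ^ 2) := by
          gcongr
          simpa using sq_sum_le_card_mul_sum_sq (s := Finset.univ) (f := fun k => ‖c k‖)
      _ = _ := by ring
  have h2 : star c ⬝ᵥ ((((t * m : ℝ) : ℂ) • (1 : Matrix (Fin m) (Fin m) ℂ)) *ᵥ c) =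
      ((t * m * ∑ k, ‖c k‖ ^ 2 : ℝ) : ℂ) := by
    rw [Matrix.smul_mulVec, Matrix.one_mulVec, dotProduct_smul, smul_eq_mul,
      Complex.ofReal_mul (t * m)]
    congr 1
    rw [dotProduct, Complex.ofReal_sum]
    refine Finset.sum_congr rfl fun k _ => ?_
    rw [Pi.star_apply, Complex.star_def, Complex.conj_mul', Complex.ofReal_pow]
  rw [Matrix.add_mulVec, dotProduct_add, h2, Complex.add_re, Complex.ofReal_re]
  have h3 := (abs_le.1 (Complex.abs_re_le_norm (star c ⬝ᵥ (A *ᵥ c)))).1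
  linarith

theorem IsTraceRoot.charFn_neg {ρ S : Modes n →L[ℂ] Modes n} (h : IsTraceRoot ρ S)
    (ξ : PhaseSpace n) : charFn ρ (-ξ) = conj (charFn ρ ξ) := by
  rw [charFn, charFn, ← star_displacement, h.trace_mul_star]

theorem IsTraceRoot.continuous_charFn {ρ S : Modes n →L[ℂ] Modes n} (h : IsTraceRoot ρ S) :
    Continuous (charFn ρ) :=
  h.continuous_trace_mul norm_displacement_le fun f => continuous_inner_displacement f f

theorem IsTraceRoot.exists_norm_charFn_le {ρ S : Modes n →L[ℂ] Modes n} (h : IsTraceRoot ρ S) :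
    ∃ C, ∀ ξ, ‖charFn ρ ξ‖ ≤ C := by
  refine ⟨1 * ∑' i, (inner ℂ (onb (Modes n) i) (ρ (onb (Modes n) i))).re, fun ξ =>
    (h.norm_trace_mul_le _).trans ?_⟩
  refine mul_le_mul_of_nonneg_right (norm_displacement_le ξ) (tsum_nonneg fun i => ?_)
  rw [← h.norm_sq]
  positivity

/-- The quantum Bochner theorem, easy direction. -/
theorem IsTraceRoot.posSemidef_bochnerMatrix_one {ρ S : Modes n →L[ℂ] Modes n}
    (h : IsTraceRoot ρ S) (T : Fin m → PhaseSpace n) :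
    (bochnerMatrix 1 (charFn ρ) T).PosSemidef := by
  refine Matrix.PosSemidef.of_dotProduct_mulVec_nonneg
    (isHermitian_bochnerMatrix 1 h.charFn_neg T) fun c => ?_
  -- The operator is `X = ∑ₖ conj cₖ D(ξₖ)`; the Weyl relation expands `X X†` into the entries of
  -- the matrix.
  have key : star c ⬝ᵥ (bochnerMatrix 1 (charFn ρ) T *ᵥ c) =
      trace (ρ * ((∑ k, conj (c k) • displacement (T k)) *
        star (∑ k, conj (c k) • displacement (T k)))) := by
    rw [star_dotProduct_mulVec, star_sum, Finset.sum_mul_sum, h.trace_mul_sum]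
    refine Finset.sum_congr rfl fun k _ => ?_
    rw [h.trace_mul_sum]
    refine Finset.sum_congr rfl fun l _ => ?_
    rw [star_smul, Complex.star_def, Complex.conj_conj, smul_mul_smul_comm, displacement_mul_star,
      h.trace_mul_smul, h.trace_mul_smul, bochnerMatrix, Matrix.of_apply, charFn, one_mul]
    ring
  rw [key]
  exact h.trace_mul_mul_star_nonneg _

theorem posSemidef_bochnerMatrix_zero {ω : Modes n →L[ℂ] Modes n} (hω : ω ∈ classicalStates n)
    (T : Fin m → PhaseSpace n) : (bochnerMatrix 0 (charFn ω) T).PosSemidef := by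
  obtain ⟨hst, W, ⟨hW, hF⟩, hW0⟩ := hω
  obtain ⟨S, hS⟩ := hst.exists_isTraceRoot
  obtain ⟨C, hC⟩ := hS.exists_norm_charFn_le
  refine Matrix.PosSemidef.of_dotProduct_mulVec_nonneg
    (isHermitian_bochnerMatrix 0 hS.charFn_neg T) fun c => ?_
  rw [star_dotProduct_mulVec]
  simpa [bochnerMatrix] using sum_conj_mul_mul_nonneg hS.continuous_charFn hC hW hW0 hF T c

theorem bochnerMatrix_sub (r : ℝ) (χ χ' : PhaseSpace n → ℂ) (T : Fin m → PhaseSpace n) :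
    bochnerMatrix r (χ - χ') T = bochnerMatrix r χ T - bochnerMatrix r χ' T := by
  ext k l
  simp [bochnerMatrix, sub_mul]

/-- The characteristic function of a state, together with its trace norm distance to any classical
state, is feasible. -/
theorem sdpFeasible_charFn {p : ℕ} {ρ ω : Modes n →L[ℂ] Modes n} (hρ : IsState ρ)
    (hω : ω ∈ classicalStates n) (hfin : traceNorm (ρ - ω) ≠ ∞) {ξbar : Fin p → PhaseSpace n}
    {c : Fin p → ℂ} {δ : Fin p → ℝ} (hdata : ∀ j, ‖charFn ρ (ξbar j) - c j‖ ≤ δ j)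
    (T : Fin m → PhaseSpace n) :
    SDPFeasible ξbar c δ T (charFn ρ) (traceNorm (ρ - ω)).toReal := by
  obtain ⟨S, hS⟩ := hρ.exists_isTraceRoot
  obtain ⟨S', hS'⟩ := hω.1.exists_isTraceRoot
  refine ⟨hS.charFn_neg, fun j => ?_, fun j => ?_, ?_, hS.posSemidef_bochnerMatrix_one T⟩
  · rw [← Complex.sub_re]
    exact (Complex.abs_re_le_norm _).trans (hdata j)
  · rw [← Complex.sub_im]
    exact (Complex.abs_im_le_norm _).trans (hdata j)
  · set t := (traceNorm (ρ - ω)).toReal with ht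
    have hsa : IsSelfAdjoint (ρ - ω) :=
      hρ.isPositive.isSelfAdjoint.sub hω.1.isPositive.isSelfAdjoint
    have hherm : (bochnerMatrix 0 (charFn ρ - charFn ω) T).IsHermitian := by
      rw [bochnerMatrix_sub]
      exact (isHermitian_bochnerMatrix 0 hS.charFn_neg T).sub
        (isHermitian_bochnerMatrix 0 hS'.charFn_neg T)
    have hle : ∀ k l, ‖bochnerMatrix 0 (charFn ρ - charFn ω) T k l‖ ≤ t := by
      intro k l
      simp only [bochnerMatrix, Matrix.of_apply, zero_mul, zero_div, Complex.ofReal_zero, mul_zero,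
        Complex.exp_zero, mul_one, Pi.sub_apply, charFn]
      rw [← trace_sub_mul hS hS']
      refine (norm_trace_mul_le hsa (lt_top_iff_ne_top.2 hfin) _).trans ?_
      exact mul_le_of_le_one_left ENNReal.toReal_nonneg (norm_displacement_le _)
    -- `M^{(0)}(χ_ρ) + t m = M^{(0)}(χ_ω) + (M^{(0)}(χ_ρ - χ_ω) + t m)`, a sum of two positive
    -- semidefinite matrices.
    have h := (posSemidef_bochnerMatrix_zero hω T).add
      (posSemidef_add_smul_one hherm ENNReal.toReal_nonneg hle)
    rwa [bochnerMatrix_sub, ← add_assoc, add_sub_cancel] at h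

end BochnerMatrix

end NonClassicality

theorem mainTheorem1 (n p m : ℕ)
    (ρ : NonClassicality.Modes n →L[ℂ] NonClassicality.Modes n)
    (hρ : NonClassicality.IsState ρ)
    (ξbar : Fin p → NonClassicality.PhaseSpace n) (c : Fin p → ℂ) (δ : Fin p → ℝ)
    (hdata : ∀ j, ‖NonClassicality.charFn ρ (ξbar j) - c j‖ ≤ δ j)
    (T : Fin m → NonClassicality.PhaseSpace n) :
    NonClassicality.sdpValue ξbar c δ T ≤ (NonClassicality.nonClassicality ρ : EReal) := by
  -- The optimal value may be negative or `⊥`, so it is first replaced by its positive part; the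
  -- infimum over `ω` is then handled in `ℝ≥0∞`.
  refine ((le_max_right 0 _).trans_eq EReal.coe_toENNReal_eq_max.symm).trans
    (EReal.coe_ennreal_le_coe_ennreal_iff.2 ?_)
  refine le_iInf₂ fun ω hω => ?_
  -- At infinite distance the bound is trivial, so `ρ - ω` need not be shown to be of trace class.
  rcases eq_or_ne (NonClassicality.traceNorm (ρ - ω)) ∞ with hfin | hfin
  · rw [hfin]
    exact le_top
  · have h := NonClassicality.sdpFeasible_charFn hρ hω hfin hdata T
    have h1 : NonClassicality.sdpValue ξbar c δ T ≤
        ((NonClassicality.traceNorm (ρ - ω)).toReal : EReal) :=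
      (iInf_le _ _).trans ((iInf_le _ _).trans (iInf_le _ h))
    simpa [ENNReal.ofReal_toReal hfin] using EReal.toENNReal_le_toENNReal h1
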